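/- Let $N\ge 3$, $0<s<1$, and put $2_s^*=\frac{2N}{N-2s}$, $2^*=\frac{2N}{N-2}$. Let $X$ be the completion of $C_0^\infty(\mathbb{R}^N)$ for the norm $$\|u\|_X^2=\int_{\mathbb{R}^N}|\nabla u|^2\,dx+\int_{\mathbb{R}^N}\int_{\mathbb{R}^N}\frac{|u(x)-u(y)|^2}{|x-y|^{N+2s}}\,dx\,dy ,$$ realized as a space of functions in $L^{2^*}(\mathbb{R}^N)$ by means of the Sobolev inequality. Let $f:\mathbb{R}\to\mathbb{R}$ be such that, for some $C>0$, $$|f(t)t|\le C\left(|t|^{2_s^*}+|t|^{2^*}\right)\qquad\text{for all } t\in\mathbb{R}.$$ Then every weak solution $u\in X$ of $$-\Delta u+(-\Delta)^s u=f(u)\quad\text{in }\mathbb{R}^N$$ with $u\ge 0$ almost everywhere belongs to $L^\infty(\mathbb{R}^N)$. Here $u\in X$ is called a weak solution if for every $\phi\in X$ the function $f(u)\phi$ is integrable and $$\int_{\mathbb{R}^N}\nabla u\cdot\nabla\phi\,dx+\kappa\int_{\mathbb{R}^N}\int_{\mathbb{R}^N}\frac{(u(x)-u(y))(\phi(x)-\phi(y))}{|x-y|^{N+2s}}\,dx\,dy=\int_{\mathbb{R}^N}f(u)\phi\,dx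 ,$$ where the constant $\kappa>0$ depends on the normalization of $(-\Delta)^s$; the result holds for every $\kappa>0$ (in particular for $\kappa=1$, and for the value that gives $(-\Delta)^s$ the Fourier symbol $|\xi|^{2s}$). -/

import Mathlib

open MeasureTheory Filter Topology
open scoped ContDiff Gradient ENNReal

noncomputable section

namespace MixedLocalNonlocal

/-- The Euclidean space `ℝ^N`. -/
abbrev Space (N : ℕ) : Type := EuclideanSpace ℝ (Fin N)

/-- The critical exponent `2N / (N - 2s)`: this is `2_s^*`, and for `s = 1` it is `2^*`. -/
def critExp (N : ℕ) (s : ℝ) : ℝ := 2 * N / (N - 2 * s)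

/-- `φ ∈ C_0^∞(ℝ^N)`: smooth real-valued functions with compact support. -/
def IsTestFunction {N : ℕ} (φ : Space N → ℝ) : Prop :=
  ContDiff ℝ ∞ φ ∧ HasCompactSupport φ

/-- `∬ |u(x) - u(y)|² / |x - y|^(N + 2s) dx dy`, with values in `[0, ∞]`. -/
def gagliardoSq {N : ℕ} (s : ℝ) (u : Space N → ℝ) : ℝ≥0∞ :=
  ∫⁻ p : Space N × Space N,
    ENNReal.ofReal (|u p.1 - u p.2| ^ 2 / ‖p.1 - p.2‖ ^ ((N : ℝ) + 2 * s))

/-- The square of the norm of `X` on smooth functions,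
`∫ |∇φ|² dx + ∬ |φ(x) - φ(y)|² / |x - y|^(N + 2s) dx dy`. -/
def normXSq {N : ℕ} (s : ℝ) (φ : Space N → ℝ) : ℝ≥0∞ :=
  (∫⁻ x, ‖∇ φ x‖ₑ ^ 2) + gagliardoSq s φ

/-- Membership in the mixed Sobolev space `X`, the completion of `C_0^∞(ℝ^N)` for the norm above.
An element of the completion is represented by a Cauchy sequence of test functions; by the Sobolev
inequality the sequence converges in `L^{2^*}(ℝ^N)`, and the element is identified with (the a.e.
class of) its limit `u`. -/
def MemX {N : ℕ} (s : ℝ) (u : Space N → ℝ) : Prop :=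
  MemLp u (ENNReal.ofReal (critExp N 1)) ∧
  ∃ φ : ℕ → Space N → ℝ,
    (∀ n, IsTestFunction (φ n)) ∧
    (∀ ε : ℝ≥0∞, 0 < ε → ∃ n₀, ∀ m ≥ n₀, ∀ n ≥ n₀, normXSq s (φ m - φ n) < ε) ∧
    Tendsto (fun n => eLpNorm (φ n - u) (ENNReal.ofReal (critExp N 1)) volume) atTop (𝓝 0)

/-- `G` is the weak (distributional) gradient of `u` on `ℝ^N`:
`∫ u ∇ψ dx = - ∫ ψ G dx` for all test functions `ψ`. -/
def IsWeakGradient {N : ℕ} (u : Space N → ℝ) (G : Space N → Space N) : Prop :=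
  LocallyIntegrable u ∧ LocallyIntegrable G ∧
  ∀ ψ : Space N → ℝ, IsTestFunction ψ → ∫ x, u x • ∇ ψ x = - ∫ x, ψ x • G x

/-- The bilinear form `∬ (u(x) - u(y)) (φ(x) - φ(y)) / |x - y|^(N + 2s) dx dy`. For `u` and `φ`
in `X` the integrand is integrable on `ℝ^N × ℝ^N`, by Cauchy-Schwarz. -/
def gagliardoForm {N : ℕ} (s : ℝ) (u φ : Space N → ℝ) : ℝ :=
  ∫ p : Space N × Space N,
    (u p.1 - u p.2) * (φ p.1 - φ p.2) / ‖p.1 - p.2‖ ^ ((N : ℝ) + 2 * s)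

/-- `u ∈ X` is a weak solution of `-Δu + (-Δ)^s u = f(u)` in `ℝ^N`: for all `φ ∈ X`, `f(u) φ` is
integrable and
`∫ ∇u · ∇φ dx + κ ∬ (u(x) - u(y)) (φ(x) - φ(y)) / |x - y|^(N + 2s) dx dy = ∫ f(u) φ dx`.
Here `κ > 0` is the normalisation constant of the fractional Laplacian; it is `1` in the weak
formulation without constants, and half of the usual constant `C(N, s)` if `(-Δ)^s` is to have
the Fourier symbol `|ξ|^(2s)`. The gradients are weak gradients (unique up to null sets; every
element of `X` has one, and it is square integrable). -/
def IsWeakSolution {N : ℕ} (κ s : ℝ) (f : ℝ → ℝ) (u : Space N → ℝ) : Prop :=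
  MemX s u ∧ ∃ Gu : Space N → Space N, IsWeakGradient u Gu ∧
    ∀ (φ : Space N → ℝ) (Gφ : Space N → Space N), MemX s φ → IsWeakGradient φ Gφ →
      Integrable (fun x => f (u x) * φ x) ∧
      (∫ x, inner ℝ (Gu x) (Gφ x)) + κ * gagliardoForm s u φ = ∫ x, f (u x) * φ x

end MixedLocalNonlocal

end

/-! The proof is a De Giorgi iteration on the tails `a k = ∫_{u > k} |u|^p`, with `p = 2^*`. For `1
≤ h < k`, test the equation with `g ∘ u`, where `g` is a smooth nondecreasing truncation vanishing
below `h`. The nonlocal term is nonnegative because `g` is monotone, so only `∫ g'(u) |∇u|²` remains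
on the left. On the right, `0 ≤ g(u) ≤ u` and the growth of `f` give at most `2C a(h)`. Since `0 ≤
g' ≤ 1`, also `|∇(g ∘ u)|² ≤ g'(u) |∇u|²`, and Sobolev's inequality bounds `∫ |g(u)|^p` by a
multiple of `a(h)^(p/2)`. On `{u > k}`, `g(u)` is at least a multiple of `(k - h)/k * u`. Hence `a k
≤ B (k/(k-h))^p a(h)^(p/2)`, which is `IsWeakSolution.exists_tailIntegral_le`.

The exponent `p/2` exceeds `1`, so the iteration reaches zero once some tail is small enough. The
factor `k/(k-h)` is invariant under scaling of the levels, so the required smallness does not depend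
on the starting level, and `a → 0` at infinity supplies it. This is how the critical growth is
handled (`exists_eq_zero_of_deGiorgi`).

The remaining work is to show that `g ∘ u` is an admissible test function with gradient `g'(u) ∇u`
(`IsApprox.comp`). A smooth `g` with `g 0 = 0` maps test functions to test functions, so this
follows by approximation. -/

namespace MixedLocalNonlocal

variable {N : ℕ} {s : ℝ}

/-! ### Finite Gagliardo energy of test functions -/

/-- In polar coordinates the weight is `y^(1-2s)` near zero, integrable because `s < 1`, and
`y^(-1-2s)` at infinity, integrable because `s > 0`. -/
lemma integrableOn_radial_gagliardo_weight (hN : 1 ≤ N) (hs0 : 0 < s) (hs1 : s < 1) :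
    IntegrableOn (fun y : ℝ => y ^ (N - 1) • (min 1 (y ^ 2) / y ^ ((N : ℝ) + 2 * s)))
      (Set.Ioi 0) := by
  have key : ∀ y : ℝ, 0 < y → y ^ (N - 1) / y ^ ((N : ℝ) + 2 * s) = y ^ (-1 - 2 * s) := by
    intro y hy
    rw [← Real.rpow_natCast, ← Real.rpow_sub hy]
    congr 1
    push_cast [hN]
    ring
  have h1 : IntegrableOn (fun y : ℝ => y ^ (N - 1) • (min 1 (y ^ 2) / y ^ ((N : ℝ) + 2 * s)))
      (Set.Ioc 0 1) := by
    have h : IntegrableOn (fun y : ℝ => y ^ (1 - 2 * s)) (Set.Ioc 0 1) :=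
      (intervalIntegral.intervalIntegrable_rpow' (by linarith)).1
    refine h.congr_fun (fun y hy => ?_) measurableSet_Ioc
    have hy2 : y ^ 2 ≤ 1 := by nlinarith [hy.1, hy.2]
    simp only [smul_eq_mul, min_eq_right hy2]
    rw [show y ^ (N - 1) * (y ^ 2 / y ^ ((N : ℝ) + 2 * s)) =
      y ^ (N - 1) / y ^ ((N : ℝ) + 2 * s) * y ^ 2 by ring, key y hy.1, ← Real.rpow_two,
      ← Real.rpow_add hy.1]
    ring_nf
  have h2 : IntegrableOn (fun y : ℝ => y ^ (N - 1) • (min 1 (y ^ 2) / y ^ ((N : ℝ) + 2 * s)))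
      (Set.Ioi 1) := by
    have h : IntegrableOn (fun y : ℝ => y ^ (-1 - 2 * s)) (Set.Ioi 1) :=
      integrableOn_Ioi_rpow_of_lt (by linarith) one_pos
    refine h.congr_fun (fun y hy => ?_) measurableSet_Ioi
    have hy1 : (1 : ℝ) < y := hy
    have hy2 : 1 ≤ y ^ 2 := by nlinarith
    simp only [smul_eq_mul, min_eq_left hy2]
    rw [mul_one_div, key y (by linarith)]
  rw [← Set.Ioc_union_Ioi_eq_Ioi zero_le_one]
  exact h1.union h2

lemma lintegral_gagliardo_weight_lt_top (hN : 1 ≤ N) (hs0 : 0 < s) (hs1 : s < 1) :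
    ∫⁻ z : Space N, ENNReal.ofReal (min 1 (‖z‖ ^ 2) / ‖z‖ ^ ((N : ℝ) + 2 * s)) < ⊤ := by
  have : NeZero N := ⟨by omega⟩
  have h : Integrable (fun z : Space N => min 1 (‖z‖ ^ 2) / ‖z‖ ^ ((N : ℝ) + 2 * s)) :=
    (integrable_fun_norm_addHaar (volume : Measure (Space N))
      (f := fun y : ℝ => min 1 (y ^ 2) / y ^ ((N : ℝ) + 2 * s))).2 (by
        simpa using integrableOn_radial_gagliardo_weight hN hs0 hs1)
  exact h.lintegral_lt_top

lemma IsTestFunction.gagliardoSq_lt_top (hN : 1 ≤ N) (hs0 : 0 < s) (hs1 : s < 1)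
    {φ : Space N → ℝ} (hφ : IsTestFunction φ) : gagliardoSq s φ < ⊤ := by
  obtain ⟨hφ, hc⟩ := hφ
  obtain ⟨K, hK⟩ := hφ.lipschitzWith_of_hasCompactSupport
    hc (by simp)
  obtain ⟨M, hM⟩ := hc.exists_bound_of_continuous hφ.continuous
  set D : ℝ := max (K ^ 2) ((2 * M) ^ 2)
  have hD : 0 ≤ D := le_max_of_le_left (by positivity)
  set w : Space N → ℝ≥0∞ := fun z =>
    ENNReal.ofReal (min 1 (‖z‖ ^ 2) / ‖z‖ ^ ((N : ℝ) + 2 * s)) with hw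
  have hwm : Measurable w := by simp only [hw]; fun_prop
  set S := tsupport φ
  have hS : MeasurableSet S := (isClosed_tsupport φ).measurableSet
  have hSv : volume S < ⊤ := hc.isCompact.measure_lt_top
  set χ : Space N → ℝ≥0∞ := S.indicator 1
  have hχ : Measurable χ := measurable_one.indicator hS
  -- The Lipschitz and sup bounds control the numerator by `D * min 1 (|x - y|²)`, and it vanishes
  -- unless `x` or `y` lies in the support. Each resulting term integrates, by translation
  -- invariance, to the volume of the support times `∫ w`.
  have hbound : ∀ p : Space N × Space N,
      ENNReal.ofReal (|φ p.1 - φ p.2| ^ 2 / ‖p.1 - p.2‖ ^ ((N : ℝ) + 2 * s)) ≤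
        ENNReal.ofReal D * (χ p.1 * w (p.1 - p.2) + χ p.2 * w (p.1 - p.2)) := by
    rintro ⟨x, y⟩
    have hnum : |φ x - φ y| ^ 2 ≤ D * min 1 (‖x - y‖ ^ 2) := by
      rw [mul_min_of_nonneg _ _ hD]
      refine le_min ?_ ?_
      · have h1 : |φ x - φ y| ≤ 2 * M := by
          have := abs_sub (φ x) (φ y)
          have hx := hM x
          have hy := hM y
          rw [Real.norm_eq_abs] at hx hy
          linarith
        calc |φ x - φ y| ^ 2 ≤ (2 * M) ^ 2 := by gcongr
          _ ≤ D * 1 := by rw [mul_one]; exact le_max_right _ _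
      · have h1 : |φ x - φ y| ≤ K * ‖x - y‖ := by
          simpa [Real.dist_eq, dist_eq_norm] using hK.dist_le_mul x y
        calc |φ x - φ y| ^ 2 ≤ (K * ‖x - y‖) ^ 2 := by gcongr
          _ = K ^ 2 * ‖x - y‖ ^ 2 := by ring
          _ ≤ D * ‖x - y‖ ^ 2 := by gcongr; exact le_max_left _ _
    have hle : ENNReal.ofReal (|φ x - φ y| ^ 2 / ‖x - y‖ ^ ((N : ℝ) + 2 * s)) ≤
        ENNReal.ofReal D * w (x - y) := by
      rw [hw, ← ENNReal.ofReal_mul hD]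
      refine ENNReal.ofReal_le_ofReal ?_
      rw [mul_div_assoc']
      gcongr
    by_cases hx : x ∈ S
    · refine hle.trans ?_
      gcongr
      simp [χ, hx]
    by_cases hy : y ∈ S
    · refine hle.trans ?_
      gcongr
      simp [χ, hy]
    · simp [image_eq_zero_of_notMem_tsupport hx, image_eq_zero_of_notMem_tsupport hy]
  refine (lintegral_mono hbound).trans_lt ?_
  rw [lintegral_const_mul _ (by fun_prop), lintegral_add_left (by fun_prop)]
  have hW := lintegral_gagliardo_weight_lt_top hN hs0 hs1
  have hχi : ∫⁻ x, χ x = volume S := by simp [χ, lintegral_indicator hS]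
  have e1 : ∫⁻ p : Space N × Space N, χ p.1 * w (p.1 - p.2) = volume S * ∫⁻ z, w z := by
    rw [Measure.volume_eq_prod, lintegral_prod _ (by fun_prop)]
    have h : ∀ x, ∫⁻ y, χ x * w (x - y) = χ x * ∫⁻ z, w z := fun x => by
      rw [lintegral_const_mul _ (by fun_prop), lintegral_sub_left_eq_self w]
    simp only [h]
    rw [lintegral_mul_const _ hχ, hχi]
  have e2 : ∫⁻ p : Space N × Space N, χ p.2 * w (p.1 - p.2) = volume S * ∫⁻ z, w z := by
    rw [Measure.volume_eq_prod, lintegral_prod_symm _ (by fun_prop)]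
    have h : ∀ x, ∫⁻ y, χ x * w (y - x) = χ x * ∫⁻ z, w z := fun x => by
      rw [lintegral_const_mul _ (by fun_prop), lintegral_sub_right_eq_self w]
    simp only [h]
    rw [lintegral_mul_const _ hχ, hχi]
  rw [e1, e2]
  have := ENNReal.mul_lt_top hSv hW
  exact ENNReal.mul_lt_top ENNReal.ofReal_lt_top (ENNReal.add_lt_top.2 ⟨this, this⟩)

/-! ### Convergence in `L^p` -/

lemma exists_tendsto_eLpNorm_two_of_cauchy {α E : Type*} [MeasurableSpace α] {μ : Measure α}
    [NormedAddCommGroup E] [CompleteSpace E] {F : ℕ → α → E} (hF : ∀ n, MemLp (F n) 2 μ)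
    (hc : ∀ ε : ℝ≥0∞, 0 < ε → ∃ n₀, ∀ m ≥ n₀, ∀ n ≥ n₀, eLpNorm (F m - F n) 2 μ < ε) :
    ∃ H : α → E, MemLp H 2 μ ∧ Tendsto (fun n => eLpNorm (F n - H) 2 μ) atTop (𝓝 0) := by
  have hcs : CauchySeq fun n => (hF n).toLp (F n) := by
    rw [EMetric.cauchySeq_iff]
    intro ε hε
    obtain ⟨n₀, hn⟩ := hc ε hε
    refine ⟨n₀, fun m hm n hn' => ?_⟩
    rw [Lp.edist_toLp_toLp]
    exact hn m hm n hn'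
  obtain ⟨H, hH⟩ := cauchySeq_tendsto_of_complete hcs
  refine ⟨H, Lp.memLp H, ?_⟩
  rw [Lp.tendsto_Lp_iff_tendsto_eLpNorm'] at hH
  refine hH.congr fun n => eLpNorm_congr_ae ?_
  exact (hF n).coeFn_toLp.sub (ae_eq_refl _)

lemma exists_subseq_tendsto_ae_of_tendsto_eLpNorm {α E : Type*} [MeasurableSpace α]
    {μ : Measure α} [NormedAddCommGroup E] {F : ℕ → α → E} {H : α → E} {p : ℝ≥0∞} (hp : p ≠ 0)
    (hF : ∀ n, AEStronglyMeasurable (F n) μ) (hH : AEStronglyMeasurable H μ)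
    (h : Tendsto (fun n => eLpNorm (F n - H) p μ) atTop (𝓝 0)) :
    ∃ ns : ℕ → ℕ, StrictMono ns ∧ ∀ᵐ x ∂μ, Tendsto (fun i => F (ns i) x) atTop (𝓝 (H x)) :=
  (tendstoInMeasure_of_tendsto_eLpNorm hp hF hH h).exists_seq_tendsto_ae

/-- Multiplying a sequence that converges in `L²` by a bounded sequence of coefficients that
converges wherever the limit does not vanish preserves convergence in `L²`. -/
lemma tendsto_eLpNorm_smul_sub_smul {α E : Type*} [MeasurableSpace α] {μ : Measure α}
    [NormedAddCommGroup E] [NormedSpace ℝ E] {F : ℕ → α → E} {H : α → E} {a : ℕ → α → ℝ}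
    {b : α → ℝ} (hF : ∀ n, AEStronglyMeasurable (F n) μ) (hH : MemLp H 2 μ)
    (ha : ∀ n, AEStronglyMeasurable (a n) μ) (hb : AEStronglyMeasurable b μ)
    (ha1 : ∀ n x, |a n x| ≤ 1) (hb1 : ∀ x, |b x| ≤ 1)
    (hFH : Tendsto (fun n => eLpNorm (F n - H) 2 μ) atTop (𝓝 0))
    (hab : ∀ᵐ x ∂μ, Tendsto (fun n => a n x • H x) atTop (𝓝 (b x • H x))) :
    Tendsto (fun n => eLpNorm ((fun x => a n x • F n x) - fun x => b x • H x) 2 μ) atTop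
      (𝓝 0) := by
  have hHm := hH.aestronglyMeasurable
  -- Split `a_n F_n - b H = a_n (F_n - H) + (a_n - b) H`. The second term is handled by dominated
  -- convergence with majorant `2|H|`.
  have h2 : Tendsto (fun n => eLpNorm (fun x => (a n x - b x) • H x) 2 μ) atTop (𝓝 0) := by
    have h3 : Tendsto (fun n => ∫⁻ x, ‖(a n x - b x) • H x‖ₑ ^ (2 : ℝ) ∂μ) atTop
        (𝓝 (∫⁻ _, 0 ∂μ)) := by
      refine tendsto_lintegral_of_dominated_convergence' (fun x => ‖(2 : ℝ) • H x‖ₑ ^ (2 : ℝ))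
        (fun n => ((((ha n).sub hb).smul hHm).enorm.pow_const _)) (fun n => ?_) ?_ ?_
      · refine Eventually.of_forall fun x => ?_
        simp only
        gcongr
        rw [enorm_le_iff_norm_le, norm_smul, norm_smul]
        gcongr
        have := abs_sub (a n x) (b x)
        simp only [Real.norm_eq_abs, abs_two]
        linarith [ha1 n x, hb1 x]
      · have := (lintegral_rpow_enorm_lt_top_of_eLpNorm_lt_top two_ne_zero ENNReal.ofNat_ne_top
          (hH.const_smul (2 : ℝ)).2)
        simpa using this.ne
      · filter_upwards [hab] with x hx
        have h4 : Tendsto (fun n => (a n x - b x) • H x) atTop (𝓝 0) := by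
          simpa [sub_smul] using hx.sub_const (b x • H x)
        have h5 := (ENNReal.continuous_rpow_const (y := (2 : ℝ))).tendsto _ |>.comp h4.enorm
        simpa [Function.comp_def] using h5
    rw [lintegral_zero] at h3
    have h4 := (ENNReal.continuous_rpow_const (y := (1 / 2 : ℝ))).tendsto _ |>.comp h3
    simp only [eLpNorm_eq_lintegral_rpow_enorm_toReal two_ne_zero ENNReal.ofNat_ne_top]
    simpa [Function.comp_def] using h4
  refine tendsto_of_tendsto_of_tendsto_of_le_of_le tendsto_const_nhds
    (by simpa using hFH.add h2) (fun _ => zero_le) (fun n => ?_)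
  have e : ((fun x => a n x • F n x) - fun x => b x • H x) =
      (fun x => a n x • (F n - H) x) + fun x => (a n x - b x) • H x := by
    ext x
    simp [smul_sub, sub_smul]
  rw [e]
  refine (eLpNorm_add_le ((ha n).smul ((hF n).sub hHm)) (((ha n).sub hb).smul hHm)
    one_le_two).trans ?_
  refine add_le_add (eLpNorm_mono fun x => ?_) le_rfl
  rw [Pi.smul_apply', norm_smul]
  exact mul_le_of_le_one_left (norm_nonneg _) (ha1 n x)

lemma tendsto_integral_smul_of_tendsto_eLpNorm {α E : Type*} [MeasurableSpace α] {μ : Measure α}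
    [NormedAddCommGroup E] [NormedSpace ℝ E] {p q : ℝ≥0∞} [p.HolderConjugate q]
    {F : ℕ → α → ℝ} {H : α → ℝ} {G : α → E} (hF : ∀ n, MemLp (F n) p μ) (hH : MemLp H p μ)
    (hG : MemLp G q μ) (h : Tendsto (fun n => eLpNorm (F n - H) p μ) atTop (𝓝 0)) :
    Tendsto (fun n => ∫ x, F n x • G x ∂μ) atTop (𝓝 (∫ x, H x • G x ∂μ)) := by
  refine tendsto_integral_of_L1' _ (hH.1.smul hG.1)
    (Eventually.of_forall fun n => memLp_one_iff_integrable.1 (hG.smul (hF n))) ?_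
  refine tendsto_of_tendsto_of_tendsto_of_le_of_le tendsto_const_nhds
    (h := fun n => eLpNorm (F n - H) p μ * eLpNorm G q μ) ?_ (fun _ => zero_le) (fun n => ?_)
  · simpa using ENNReal.Tendsto.mul_const h (Or.inr hG.2.ne)
  · have e : ((fun x => F n x • G x) - fun x => H x • G x) = (F n - H) • G := by
      ext x
      simp [sub_smul]
    change eLpNorm ((fun x => F n x • G x) - fun x => H x • G x) 1 μ ≤ _
    rw [e]
    exact eLpNorm_smul_le_mul_eLpNorm (r := 1) hG.1 ((hF n).1.sub hH.1)

lemma tendsto_integral_smul_of_tendsto_eLpNorm_right {α E : Type*} [MeasurableSpace α]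
    {μ : Measure α} [NormedAddCommGroup E] [NormedSpace ℝ E] {p q : ℝ≥0∞} [p.HolderConjugate q]
    {F : ℕ → α → E} {H : α → E} {G : α → ℝ} (hF : ∀ n, MemLp (F n) q μ) (hH : MemLp H q μ)
    (hG : MemLp G p μ) (h : Tendsto (fun n => eLpNorm (F n - H) q μ) atTop (𝓝 0)) :
    Tendsto (fun n => ∫ x, G x • F n x ∂μ) atTop (𝓝 (∫ x, G x • H x ∂μ)) := by
  refine tendsto_integral_of_L1' _ (hG.1.smul hH.1)
    (Eventually.of_forall fun n => memLp_one_iff_integrable.1 ((hF n).smul hG)) ?_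
  refine tendsto_of_tendsto_of_tendsto_of_le_of_le tendsto_const_nhds
    (h := fun n => eLpNorm G p μ * eLpNorm (F n - H) q μ) ?_ (fun _ => zero_le) (fun n => ?_)
  · simpa using ENNReal.Tendsto.const_mul h (Or.inr hG.2.ne)
  · have e : ((fun x => G x • F n x) - fun x => G x • H x) = G • (F n - H) := by
      ext x
      simp [smul_sub]
    change eLpNorm ((fun x => G x • F n x) - fun x => G x • H x) 1 μ ≤ _
    rw [e]
    exact eLpNorm_smul_le_mul_eLpNorm (r := 1) ((hF n).1.sub hH.1) hG.1

/-! ### Difference quotients and gradients of test functions -/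

/-- `(v x - v y) / |x - y|^((N + 2s) / 2)`, whose squared `L²` norm is `gagliardoSq s v`. -/
noncomputable def diffQuot (s : ℝ) (v : Space N → ℝ) (p : Space N × Space N) : ℝ :=
  (v p.1 - v p.2) / ‖p.1 - p.2‖ ^ (((N : ℝ) + 2 * s) / 2)

lemma diffQuot_sub (s : ℝ) (v w : Space N → ℝ) :
    diffQuot s (v - w) = diffQuot s v - diffQuot s w := by
  ext p
  simp only [diffQuot, Pi.sub_apply]
  ring

lemma eLpNorm_two_sq {α E : Type*} [MeasurableSpace α] (μ : Measure α)
    [NormedAddCommGroup E] (F : α → E) : eLpNorm F 2 μ ^ 2 = ∫⁻ x, ‖F x‖ₑ ^ 2 ∂μ := by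
  rw [eLpNorm_eq_lintegral_rpow_enorm_toReal two_ne_zero ENNReal.ofNat_ne_top,
    ← ENNReal.rpow_natCast, ← ENNReal.rpow_mul]
  simp

lemma gagliardoSq_eq_eLpNorm_diffQuot_sq (s : ℝ) (v : Space N → ℝ) :
    gagliardoSq s v = eLpNorm (diffQuot s v) 2 volume ^ 2 := by
  rw [eLpNorm_two_sq, gagliardoSq]
  refine lintegral_congr fun p => ?_
  rw [← ofReal_norm, ← ENNReal.ofReal_pow (norm_nonneg _), diffQuot, norm_div, div_pow,
    Real.norm_eq_abs, Real.norm_of_nonneg (by positivity), ← Real.rpow_natCast (‖p.1 - p.2‖ ^ _),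
    ← Real.rpow_mul (norm_nonneg _)]
  congr 3
  push_cast
  ring

lemma aestronglyMeasurable_diffQuot {v : Space N → ℝ} (s : ℝ)
    (hv : AEStronglyMeasurable v volume) : AEStronglyMeasurable (diffQuot s v) volume := by
  have h1 : AEMeasurable (fun p : Space N × Space N => v p.1) (volume.prod volume) :=
    hv.aemeasurable.comp_quasiMeasurePreserving Measure.quasiMeasurePreserving_fst
  have h2 : AEMeasurable (fun p : Space N × Space N => v p.2) (volume.prod volume) :=
    hv.aemeasurable.comp_quasiMeasurePreserving Measure.quasiMeasurePreserving_snd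
  have h3 : Measurable fun p : Space N × Space N =>
    ‖p.1 - p.2‖ ^ (((N : ℝ) + 2 * s) / 2) := by fun_prop
  exact ((h1.sub h2).div h3.aemeasurable).aestronglyMeasurable

lemma IsTestFunction.continuous_gradient {φ : Space N → ℝ} (hφ : IsTestFunction φ) :
    Continuous (∇ φ) :=
  (InnerProductSpace.toDual ℝ (Space N)).symm.continuous.comp (hφ.1.continuous_fderiv (by simp))

lemma IsTestFunction.hasCompactSupport_gradient {φ : Space N → ℝ} (hφ : IsTestFunction φ) :
    HasCompactSupport (∇ φ) :=
  (hφ.2.fderiv ℝ).comp_left (map_zero _)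

lemma IsTestFunction.gradient_sub {φ ψ : Space N → ℝ} (hφ : IsTestFunction φ)
    (hψ : IsTestFunction ψ) : ∇ (φ - ψ) = ∇ φ - ∇ ψ := by
  ext1 x
  simp only [gradient, Pi.sub_apply]
  rw [fderiv_sub (hφ.1.differentiable (by simp) x) (hψ.1.differentiable (by simp) x), map_sub]

lemma IsTestFunction.memLp {φ : Space N → ℝ} (hφ : IsTestFunction φ) (p : ℝ≥0∞) :
    MemLp φ p volume :=
  hφ.1.continuous.memLp_of_hasCompactSupport hφ.2

lemma IsTestFunction.memLp_gradient {φ : Space N → ℝ} (hφ : IsTestFunction φ) (p : ℝ≥0∞) :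
    MemLp (∇ φ) p volume :=
  hφ.continuous_gradient.memLp_of_hasCompactSupport hφ.hasCompactSupport_gradient

lemma IsTestFunction.memLp_diffQuot (hN : 1 ≤ N) (hs0 : 0 < s) (hs1 : s < 1)
    {φ : Space N → ℝ} (hφ : IsTestFunction φ) : MemLp (diffQuot s φ) 2 volume := by
  refine ⟨aestronglyMeasurable_diffQuot s hφ.1.continuous.aestronglyMeasurable, ?_⟩
  have := hφ.gagliardoSq_lt_top hN hs0 hs1
  rw [gagliardoSq_eq_eLpNorm_diffQuot_sq] at this
  exact (ENNReal.pow_lt_top_iff.1 this).resolve_right two_ne_zero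

lemma normXSq_sub {φ ψ : Space N → ℝ} (hφ : IsTestFunction φ) (hψ : IsTestFunction ψ) :
    normXSq s (φ - ψ) = eLpNorm (∇ φ - ∇ ψ) 2 volume ^ 2 +
      eLpNorm (diffQuot s φ - diffQuot s ψ) 2 volume ^ 2 := by
  rw [normXSq, gagliardoSq_eq_eLpNorm_diffQuot_sq, diffQuot_sub, hφ.gradient_sub hψ,
    ← eLpNorm_two_sq]

lemma critExp_one_eq (N : ℕ) : critExp N 1 = 2 * N / (N - 2) := by
  simp [critExp]

lemma two_lt_critExp_one (hN : 3 ≤ N) : 2 < critExp N 1 := by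
  have h : (3 : ℝ) ≤ N := by exact_mod_cast hN
  rw [critExp_one_eq, lt_div_iff₀ (by linarith)]
  linarith

/-! ### Approximation of elements of `X` and their weak gradients -/

/-- Test functions `φ n` approximate `u` in the Sobolev space `X`, with gradients converging to
`H` in `L²`, and almost everywhere. -/
structure IsApprox (s : ℝ) (u : Space N → ℝ) (H : Space N → Space N) (φ : ℕ → Space N → ℝ) :
    Prop where
  isTestFunction : ∀ n, IsTestFunction (φ n)
  memLp : MemLp u (ENNReal.ofReal (critExp N 1)) volume
  memLp_gradient : MemLp H 2 volume
  memLp_diffQuot : MemLp (diffQuot s u) 2 volume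
  tendsto : Tendsto (fun n => eLpNorm (φ n - u) (ENNReal.ofReal (critExp N 1)) volume) atTop (𝓝 0)
  tendsto_gradient : Tendsto (fun n => eLpNorm (∇ (φ n) - H) 2 volume) atTop (𝓝 0)
  tendsto_diffQuot :
    Tendsto (fun n => eLpNorm (diffQuot s (φ n) - diffQuot s u) 2 volume) atTop (𝓝 0)
  ae_tendsto : ∀ᵐ x, Tendsto (fun n => φ n x) atTop (𝓝 (u x))

lemma ae_tendsto_prod {φ : ℕ → Space N → ℝ} {u : Space N → ℝ}
    (h : ∀ᵐ x, Tendsto (fun n => φ n x) atTop (𝓝 (u x))) :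
    ∀ᵐ p : Space N × Space N, Tendsto (fun n => φ n p.1) atTop (𝓝 (u p.1)) ∧
      Tendsto (fun n => φ n p.2) atTop (𝓝 (u p.2)) := by
  rw [Measure.volume_eq_prod]
  filter_upwards [Measure.quasiMeasurePreserving_fst.ae h,
    Measure.quasiMeasurePreserving_snd.ae h] with p h1 h2 using ⟨h1, h2⟩

/-- A Cauchy sequence in `X` is Cauchy in `L²` separately for gradients and for difference
quotients, so both converge by completeness. -/
lemma MemX.exists_isApprox (hN : 3 ≤ N) (hs0 : 0 < s) (hs1 : s < 1) {u : Space N → ℝ}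
    (hu : MemX s u) : ∃ H φ, IsApprox s u H φ := by
  obtain ⟨huL, φ, hφ, hc, hφu⟩ := hu
  have h2 := two_lt_critExp_one hN
  have hp0 : ENNReal.ofReal (critExp N 1) ≠ 0 := by
    simpa using by linarith
  have hlt : ∀ {a b ε : ℝ≥0∞}, a ^ 2 ≤ b → b < ε ^ 2 → a < ε := fun h1 h2 =>
    lt_of_not_ge fun h => (pow_le_pow_left₀ zero_le h 2).not_gt (h1.trans_lt h2)
  obtain ⟨H, hH, hφH⟩ := exists_tendsto_eLpNorm_two_of_cauchy
    (fun n => (hφ n).memLp_gradient 2) (fun ε hε => by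
      obtain ⟨n₀, h⟩ := hc (ε ^ 2) (by positivity)
      refine ⟨n₀, fun m hm n hn => hlt ?_ (h m hm n hn)⟩
      rw [normXSq_sub (hφ m) (hφ n)]
      exact le_self_add)
  obtain ⟨F, hF, hφF⟩ := exists_tendsto_eLpNorm_two_of_cauchy
    (fun n => (hφ n).memLp_diffQuot (by omega) hs0 hs1) (fun ε hε => by
      obtain ⟨n₀, h⟩ := hc (ε ^ 2) (by positivity)
      refine ⟨n₀, fun m hm n hn => hlt ?_ (h m hm n hn)⟩
      rw [normXSq_sub (hφ m) (hφ n)]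
      exact le_add_self)
  obtain ⟨ns, hns, hns'⟩ := exists_subseq_tendsto_ae_of_tendsto_eLpNorm hp0
    (fun n => ((hφ n).memLp 2).1) huL.1 hφu
  obtain ⟨ms, hms, hms'⟩ := exists_subseq_tendsto_ae_of_tendsto_eLpNorm two_ne_zero
    (fun n => ((hφ (ns n)).memLp_diffQuot (by omega) hs0 hs1).1) hF.1
    (hφF.comp hns.tendsto_atTop)
  -- Along an almost everywhere convergent subsequence the quotients also converge pointwise to that
  -- of `u`, which identifies their `L²` limit.
  have hFu : F =ᵐ[volume] diffQuot s u := by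
    filter_upwards [hms', ae_tendsto_prod hns'] with p hp hp'
    refine tendsto_nhds_unique hp ?_
    exact ((hp'.1.comp hms.tendsto_atTop).sub (hp'.2.comp hms.tendsto_atTop)).div_const _
  refine ⟨H, fun n => φ (ns n), fun n => hφ _, huL, hH, hF.ae_eq hFu, hφu.comp hns.tendsto_atTop,
    hφH.comp hns.tendsto_atTop, ?_, hns'⟩
  refine (hφF.comp hns.tendsto_atTop).congr fun n => eLpNorm_congr_ae ?_
  exact (ae_eq_refl _).sub hFu

lemma IsApprox.memX {u : Space N → ℝ} {H : Space N → Space N} {φ : ℕ → Space N → ℝ}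
    (h : IsApprox s u H φ) : MemX s u := by
  refine ⟨h.memLp, φ, h.isTestFunction, fun ε hε => ?_, h.tendsto⟩
  have key : Tendsto (fun q : ℕ × ℕ =>
      (eLpNorm (∇ (φ q.1) - H) 2 volume + eLpNorm (∇ (φ q.2) - H) 2 volume) ^ 2 +
      (eLpNorm (diffQuot s (φ q.1) - diffQuot s u) 2 volume +
        eLpNorm (diffQuot s (φ q.2) - diffQuot s u) 2 volume) ^ 2) atTop (𝓝 0) := by
    rw [← prod_atTop_atTop_eq]
    have h1 := (h.tendsto_gradient.comp (tendsto_fst (f := atTop) (g := (atTop : Filter ℕ)))).add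
      (h.tendsto_gradient.comp (tendsto_snd (f := (atTop : Filter ℕ)) (g := atTop)))
    have h2 := (h.tendsto_diffQuot.comp (tendsto_fst (f := atTop) (g := (atTop : Filter ℕ)))).add
      (h.tendsto_diffQuot.comp (tendsto_snd (f := (atTop : Filter ℕ)) (g := atTop)))
    simpa [Function.comp_def] using (((ENNReal.continuous_pow 2).tendsto _).comp h1).add
      (((ENNReal.continuous_pow 2).tendsto _).comp h2)
  obtain ⟨n₀, hn₀⟩ := eventually_atTop_prod_self'.1 (key.eventually_lt_const hε)
  refine ⟨n₀, fun m hm n hn => lt_of_le_of_lt ?_ (hn₀ m hm n hn)⟩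
  have hsub : ∀ {α E : Type} [MeasurableSpace α] [NormedAddCommGroup E] {μ : Measure α}
      {A B C : α → E}, AEStronglyMeasurable A μ → AEStronglyMeasurable B μ →
      AEStronglyMeasurable C μ →
      eLpNorm (A - B) 2 μ ≤ eLpNorm (A - C) 2 μ + eLpNorm (B - C) 2 μ := by
    intro α E _ _ μ A B C hA hB hC
    rw [← sub_sub_sub_cancel_right A B C]
    exact eLpNorm_sub_le (hA.sub hC) (hB.sub hC) one_le_two
  rw [normXSq_sub (h.isTestFunction m) (h.isTestFunction n)]
  have hd : ∀ n, AEStronglyMeasurable (diffQuot s (φ n)) volume := fun n =>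
    aestronglyMeasurable_diffQuot s ((h.isTestFunction n).memLp 2).1
  gcongr
  · exact hsub ((h.isTestFunction m).memLp_gradient 2).1
      ((h.isTestFunction n).memLp_gradient 2).1 h.memLp_gradient.1
  · exact hsub (hd m) (hd n) h.memLp_diffQuot.1

lemma IsTestFunction.integral_smul_gradient {φ ψ : Space N → ℝ} (hφ : IsTestFunction φ)
    (hψ : IsTestFunction ψ) : ∫ x, φ x • ∇ ψ x = -∫ x, ψ x • ∇ φ x := by
  have hint : ∀ {φ ψ : Space N → ℝ}, IsTestFunction φ → IsTestFunction ψ →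
      Integrable fun x => φ x • ∇ ψ x := fun hφ hψ =>
    (hφ.1.continuous.smul hψ.continuous_gradient).integrable_of_hasCompactSupport
      hφ.2.smul_right
  refine ext_inner_left ℝ fun v => ?_
  have hinner : ∀ (φ ψ : Space N → ℝ) x, inner ℝ v (φ x • ∇ ψ x) = φ x * fderiv ℝ ψ x v := by
    intro φ ψ x
    rw [real_inner_smul_right, real_inner_comm, gradient, InnerProductSpace.toDual_symm_apply]
  have hint' : ∀ {φ ψ : Space N → ℝ}, IsTestFunction φ → IsTestFunction ψ →
      Integrable fun x => φ x * fderiv ℝ ψ x v := fun hφ hψ => by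
    simpa only [hinner] using (hint hφ hψ).const_inner (𝕜 := ℝ) v
  rw [inner_neg_right, ← integral_inner (hint hφ hψ), ← integral_inner (hint hψ hφ)]
  simp only [hinner]
  rw [integral_mul_fderiv_eq_neg_fderiv_mul_of_integrable]
  · simp only [mul_comm]
  · simpa only [mul_comm] using hint' hψ hφ
  · exact hint' hφ hψ
  · exact (hφ.1.continuous.mul hψ.1.continuous).integrable_of_hasCompactSupport hφ.2.mul_right
  · exact fun x _ => hφ.1.differentiable (by simp) x
  · exact fun x _ => hψ.1.differentiable (by simp) x

/-- Integration by parts for the approximants passes to the limit: the functions converge in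
`L^(2^*)`, the gradients in `L²`, and `ψ` and `∇ψ` lie in the dual spaces. -/
lemma IsApprox.isWeakGradient (hN : 3 ≤ N) {u : Space N → ℝ} {H : Space N → Space N}
    {φ : ℕ → Space N → ℝ} (h : IsApprox s u H φ) : IsWeakGradient u H := by
  have h2 := two_lt_critExp_one hN
  refine ⟨h.memLp.locallyIntegrable (by rw [ENNReal.one_le_ofReal]; linarith),
    h.memLp_gradient.locallyIntegrable one_le_two, fun ψ hψ => ?_⟩
  have : (ENNReal.ofReal (critExp N 1)).HolderConjugate
      (ENNReal.ofReal (Real.conjExponent (critExp N 1))) :=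
    (Real.HolderConjugate.conjExponent (by linarith)).ennrealOfReal
  have e1 := tendsto_integral_smul_of_tendsto_eLpNorm
    (q := ENNReal.ofReal (Real.conjExponent (critExp N 1)))
    (fun n => (h.isTestFunction n).memLp _) h.memLp (hψ.memLp_gradient _) h.tendsto
  have e2 := tendsto_integral_smul_of_tendsto_eLpNorm_right (p := 2) (q := 2)
    (fun n => (h.isTestFunction n).memLp_gradient 2) h.memLp_gradient (hψ.memLp 2)
    h.tendsto_gradient
  refine tendsto_nhds_unique e1 (e2.neg.congr fun n => ?_)
  rw [(h.isTestFunction n).integral_smul_gradient hψ]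

/-- This allows the gradient given with the weak solution to be exchanged for the `L²` limit `H`. -/
lemma IsWeakGradient.ae_eq {u : Space N → ℝ} {G H : Space N → Space N}
    (hG : IsWeakGradient u G) (hH : IsWeakGradient u H) : G =ᵐ[volume] H :=
  ae_eq_of_integral_contDiff_smul_eq hG.2.1 hH.2.1 fun ψ hψ hc => by
    rw [← neg_inj, ← hG.2.2 ψ ⟨hψ, hc⟩, ← hH.2.2 ψ ⟨hψ, hc⟩]

/-! ### Composition with smooth contractions -/

lemma IsTestFunction.comp {φ : Space N → ℝ} (hφ : IsTestFunction φ) {g : ℝ → ℝ}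
    (hg : ContDiff ℝ ∞ g) (hg0 : g 0 = 0) : IsTestFunction (g ∘ φ) :=
  ⟨hg.comp hφ.1, hφ.2.comp_left hg0⟩

lemma IsTestFunction.gradient_comp {φ : Space N → ℝ} (hφ : IsTestFunction φ) {g : ℝ → ℝ}
    (hg : ContDiff ℝ ∞ g) : ∇ (g ∘ φ) = fun x => deriv g (φ x) • ∇ φ x := by
  ext1 x
  rw [gradient, gradient, ← map_smul, ((hg.differentiable (by simp) _).hasDerivAt.comp_hasFDerivAt x
    (hφ.1.differentiable (by simp) x).hasFDerivAt).fderiv]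

lemma abs_sub_le_abs_sub_of_abs_deriv_le_one {g : ℝ → ℝ} (hg : Differentiable ℝ g)
    (hg1 : ∀ t, |deriv g t| ≤ 1) (a b : ℝ) : |g a - g b| ≤ |a - b| := by
  have := Convex.norm_image_sub_le_of_norm_deriv_le (s := Set.univ) (C := 1) (x := b) (y := a)
    (fun x _ => hg x) (fun x _ => hg1 x) convex_univ trivial trivial
  simpa using this

lemma IsApprox.comp {u : Space N → ℝ} {H : Space N → Space N} {φ : ℕ → Space N → ℝ}
    (h : IsApprox s u H φ) {g : ℝ → ℝ} (hg : ContDiff ℝ ∞ g) (hg0 : g 0 = 0)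
    (hg1 : ∀ t, |deriv g t| ≤ 1) :
    IsApprox s (g ∘ u) (fun x => deriv g (u x) • H x) (fun n => g ∘ φ n) := by
  have hlip := abs_sub_le_abs_sub_of_abs_deriv_le_one (hg.differentiable (by simp)) hg1
  have hgc : Continuous g := hg.continuous
  have hgd : Continuous (deriv g) := hg.continuous_deriv (by simp)
  -- A discrete chain rule: the quotient of `g ∘ v` is that of `v` times the slope `q v`, which is
  -- bounded by `1` and is `0` by convention where `v p.1 = v p.2`.
  set q : (Space N → ℝ) → Space N × Space N → ℝ := fun v p =>
    (g (v p.1) - g (v p.2)) / (v p.1 - v p.2) with hq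
  have hqD : ∀ v : Space N → ℝ, diffQuot s (g ∘ v) = fun p => q v p • diffQuot s v p := by
    intro v
    ext p
    simp only [diffQuot, hq, Function.comp, smul_eq_mul]
    rcases eq_or_ne (v p.1) (v p.2) with e | e
    · simp [e]
    · have := sub_ne_zero.2 e
      rw [mul_div_assoc', div_mul_cancel₀ _ this]
  have hq1 : ∀ v p, |q v p| ≤ 1 := fun v p => by
    simp only [hq, abs_div]
    exact div_le_one_of_le₀ (hlip _ _) (abs_nonneg _)
  have hqm : ∀ {v : Space N → ℝ}, AEStronglyMeasurable v volume →
      AEStronglyMeasurable (q v) volume := by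
    intro v hv
    have h1 : AEMeasurable (fun p : Space N × Space N => v p.1) (volume.prod volume) :=
      hv.aemeasurable.comp_quasiMeasurePreserving Measure.quasiMeasurePreserving_fst
    have h2 : AEMeasurable (fun p : Space N × Space N => v p.2) (volume.prod volume) :=
      hv.aemeasurable.comp_quasiMeasurePreserving Measure.quasiMeasurePreserving_snd
    exact (((hgc.measurable.comp_aemeasurable h1).sub (hgc.measurable.comp_aemeasurable h2)).div
      (h1.sub h2)).aestronglyMeasurable
  have hφm : ∀ n, AEStronglyMeasurable (φ n) volume := fun n => ((h.isTestFunction n).memLp 2).1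
  have hum := h.memLp.1
  constructor
  · exact fun n => (h.isTestFunction n).comp hg hg0
  · refine h.memLp.of_le (hgc.comp_aestronglyMeasurable hum) (Eventually.of_forall fun x => ?_)
    simpa [hg0] using hlip (u x) 0
  · refine h.memLp_gradient.of_le ((hgd.comp_aestronglyMeasurable hum).smul h.memLp_gradient.1)
      (Eventually.of_forall fun x => ?_)
    rw [norm_smul]
    exact mul_le_of_le_one_left (norm_nonneg _) (hg1 _)
  · rw [hqD]
    refine h.memLp_diffQuot.of_le ((hqm hum).smul h.memLp_diffQuot.1)
      (Eventually.of_forall fun x => ?_)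
    rw [norm_smul]
    exact mul_le_of_le_one_left (norm_nonneg _) (hq1 _ _)
  · refine tendsto_of_tendsto_of_tendsto_of_le_of_le tendsto_const_nhds h.tendsto
      (fun _ => zero_le) (fun n => eLpNorm_mono fun x => ?_)
    exact hlip (φ n x) (u x)
  · simp only [(h.isTestFunction _).gradient_comp hg]
    refine tendsto_eLpNorm_smul_sub_smul (fun n => ((h.isTestFunction n).memLp_gradient 2).1)
      h.memLp_gradient (fun n => hgd.comp_aestronglyMeasurable (hφm n))
      (hgd.comp_aestronglyMeasurable hum) (fun n x => hg1 _) (fun x => hg1 _)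
      h.tendsto_gradient ?_
    filter_upwards [h.ae_tendsto] with x hx
    exact ((hgd.tendsto _).comp hx).smul_const _
  · simp only [hqD]
    refine tendsto_eLpNorm_smul_sub_smul (fun n => aestronglyMeasurable_diffQuot s (hφm n))
      h.memLp_diffQuot (fun n => hqm (hφm n)) (hqm hum) (fun n x => hq1 _ _) (fun x => hq1 _ _)
      h.tendsto_diffQuot ?_
    filter_upwards [ae_tendsto_prod h.ae_tendsto] with p hp
    -- Where `u p.1 = u p.2` the slopes may fail to converge, but there the quotient of `u`
    -- vanishes.
    rcases eq_or_ne (u p.1) (u p.2) with e | e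
    · simp [diffQuot, e]
    · exact ((((hgc.tendsto _).comp hp.1).sub ((hgc.tendsto _).comp hp.2)).div
        (hp.1.sub hp.2) (sub_ne_zero.2 e)).smul_const _
  · filter_upwards [h.ae_tendsto] with x hx using (hgc.tendsto _).comp hx

/-! ### The Sobolev inequality on `X` -/

lemma IsTestFunction.eLpNorm_le_eLpNorm_gradient (hN : 3 ≤ N) {φ : Space N → ℝ}
    (hφ : IsTestFunction φ) :
    eLpNorm φ (ENNReal.ofReal (critExp N 1)) volume ≤
      SNormLESNormFDerivOfEqConst ℝ (volume : Measure (Space N)) 2 *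
        eLpNorm (∇ φ) 2 volume := by
  have hp := two_lt_critExp_one hN
  have hN' : (3 : ℝ) ≤ N := by exact_mod_cast hN
  have h := eLpNorm_le_eLpNorm_fderiv_of_eq (volume : Measure (Space N)) (hφ.1.of_le (by simp))
    hφ.2 (p := 2) (p' := (critExp N 1).toNNReal) one_le_two (by simp; omega) (by
      rw [Real.coe_toNNReal _ (by linarith), critExp_one_eq]
      simp only [finrank_euclideanSpace, Fintype.card_fin]
      have : (N : ℝ) - 2 ≠ 0 := by linarith
      push_cast
      field_simp)
  refine h.trans_eq ?_
  congr 1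
  refine eLpNorm_congr_norm_ae (Eventually.of_forall fun x => ?_)
  rw [gradient, LinearIsometryEquiv.norm_map]

lemma IsApprox.eLpNorm_le (hN : 3 ≤ N) {u : Space N → ℝ} {H : Space N → Space N}
    {φ : ℕ → Space N → ℝ} (h : IsApprox s u H φ) :
    eLpNorm u (ENNReal.ofReal (critExp N 1)) volume ≤
      SNormLESNormFDerivOfEqConst ℝ (volume : Measure (Space N)) 2 * eLpNorm H 2 volume := by
  have hp := two_lt_critExp_one hN
  have hp1 : 1 ≤ ENNReal.ofReal (critExp N 1) := by rw [ENNReal.one_le_ofReal]; linarith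
  set S := SNormLESNormFDerivOfEqConst ℝ (volume : Measure (Space N)) 2
  have hlim : Tendsto (fun n => eLpNorm (φ n - u) (ENNReal.ofReal (critExp N 1)) volume +
      S * (eLpNorm (∇ (φ n) - H) 2 volume + eLpNorm H 2 volume)) atTop
      (𝓝 (0 + S * (0 + eLpNorm H 2 volume))) :=
    h.tendsto.add (ENNReal.Tendsto.const_mul (h.tendsto_gradient.add_const _)
      (Or.inr ENNReal.coe_ne_top))
  rw [zero_add, zero_add] at hlim
  refine ge_of_tendsto' hlim fun n => ?_
  have hφ := (h.isTestFunction n)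
  calc eLpNorm u (ENNReal.ofReal (critExp N 1)) volume
      = eLpNorm (φ n - (φ n - u)) (ENNReal.ofReal (critExp N 1)) volume := by rw [sub_sub_cancel]
    _ ≤ eLpNorm (φ n) (ENNReal.ofReal (critExp N 1)) volume +
        eLpNorm (φ n - u) (ENNReal.ofReal (critExp N 1)) volume :=
      eLpNorm_sub_le (hφ.memLp 2).1 ((hφ.memLp 2).1.sub h.memLp.1) hp1
    _ ≤ S * eLpNorm (∇ (φ n)) 2 volume +
        eLpNorm (φ n - u) (ENNReal.ofReal (critExp N 1)) volume := by
      gcongr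
      exact hφ.eLpNorm_le_eLpNorm_gradient hN
    _ ≤ S * (eLpNorm (∇ (φ n) - H) 2 volume + eLpNorm H 2 volume) +
        eLpNorm (φ n - u) (ENNReal.ofReal (critExp N 1)) volume := by
      gcongr
      calc eLpNorm (∇ (φ n)) 2 volume = eLpNorm (∇ (φ n) - H + H) 2 volume := by
            rw [sub_add_cancel]
        _ ≤ _ := eLpNorm_add_le ((hφ.memLp_gradient 2).1.sub h.memLp_gradient.1)
            h.memLp_gradient.1 one_le_two
    _ = _ := add_comm _ _

/-! ### A smooth truncation -/

lemma hasDerivAt_mul_expNegInvGlue (t : ℝ) :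
    HasDerivAt (fun t => t * expNegInvGlue t) (expNegInvGlue t * (1 + t⁻¹)) t := by
  have h := (hasDerivAt_id t).mul (expNegInvGlue.hasDerivAt_polynomial_eval_inv_mul 1 t)
  simp only [Polynomial.eval_one, one_mul, Polynomial.derivative_one, sub_zero, mul_one,
    Polynomial.eval_pow, Polynomial.eval_X, id] at h
  refine h.congr_deriv ?_
  rcases eq_or_ne t 0 with rfl | ht
  · simp
  · field_simp

/-- For `t > 0` the upper bound is `1 + x ≤ exp x` at `x = 1/t`. -/
lemma expNegInvGlue_mul_mem_Icc (t : ℝ) : expNegInvGlue t * (1 + t⁻¹) ∈ Set.Icc 0 1 := by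
  rcases le_or_gt t 0 with ht | ht
  · simp [expNegInvGlue.zero_of_nonpos ht]
  · have h1 : 0 < t⁻¹ := inv_pos.2 ht
    refine ⟨mul_nonneg (expNegInvGlue.nonneg t) (by positivity), ?_⟩
    rw [expNegInvGlue, if_neg ht.not_ge, Real.exp_neg, inv_mul_le_one₀ (Real.exp_pos _)]
    linarith [Real.add_one_le_exp t⁻¹]

/-- A smooth substitute for the truncation `(t - h)⁺`. -/
lemma exists_smooth_truncation {h k : ℝ} (hh : 0 ≤ h) (hk : h < k) :
    ∃ g : ℝ → ℝ, ContDiff ℝ ∞ g ∧ (∀ t, deriv g t ∈ Set.Icc 0 1) ∧ (∀ t ≤ h, g t = 0) ∧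
      (∀ t, h ≤ t → 0 ≤ g t ∧ g t ≤ t) ∧
      ∀ t, k ≤ t → Real.exp (-1) * ((k - h) / k) * t ≤ g t := by
  have hd : 0 < k - h := sub_pos.2 hk
  -- With `G τ = τ exp(-1/τ)` for `τ > 0`, the witness is `(k - h) G((t - h)/(k - h))`. The
  -- rescaling preserves the range of the derivative. For `t ≥ k` one has `τ ≥ 1`, whence the factor
  -- `exp(-1)`.
  refine ⟨fun t => (k - h) * ((t - h) / (k - h) * expNegInvGlue ((t - h) / (k - h))),
    ?_, fun t => ?_, fun t ht => ?_, fun t ht => ?_, fun t ht => ?_⟩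
  · have h1 : ContDiff ℝ ∞ fun t : ℝ => (t - h) / (k - h) :=
      (contDiff_id.sub contDiff_const).div_const _
    exact contDiff_const.mul (h1.mul (expNegInvGlue.contDiff.comp h1))
  · have h1 : HasDerivAt (fun t : ℝ => (t - h) / (k - h)) (1 / (k - h)) t :=
      ((hasDerivAt_id t).sub_const h).div_const _
    have h2 := ((hasDerivAt_mul_expNegInvGlue ((t - h) / (k - h))).comp t h1).const_mul (k - h)
    have h3 := h2.deriv
    simp only [Function.comp_def] at h3
    rw [h3, mul_left_comm, mul_one_div_cancel hd.ne', mul_one]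
    exact expNegInvGlue_mul_mem_Icc _
  · simp only
    rw [expNegInvGlue.zero_of_nonpos (div_nonpos_of_nonpos_of_nonneg (by linarith) hd.le)]
    simp
  · have h1 : 0 ≤ t - h := by linarith
    have h2 := expNegInvGlue.nonneg ((t - h) / (k - h))
    have h3 : expNegInvGlue ((t - h) / (k - h)) ≤ 1 := by
      rw [expNegInvGlue]
      split_ifs with h4
      · exact zero_le_one
      · rw [Real.exp_le_one_iff, neg_nonpos]
        positivity
    refine ⟨by positivity, ?_⟩
    simp only
    rw [← mul_assoc, mul_div_cancel₀ _ hd.ne']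
    nlinarith
  · have hk0 : 0 < k := hh.trans_lt hk
    have h1 : 1 ≤ (t - h) / (k - h) := by rw [one_le_div hd]; linarith
    have h2 : Real.exp (-1) ≤ expNegInvGlue ((t - h) / (k - h)) := by
      rw [expNegInvGlue, if_neg (by linarith), Real.exp_le_exp, neg_le_neg_iff]
      exact inv_le_one_of_one_le₀ h1
    have h3 : (k - h) / k * t ≤ t - h := by
      rw [div_mul_eq_mul_div, div_le_iff₀ hk0]
      nlinarith
    simp only
    rw [← mul_assoc (k - h), mul_div_cancel₀ _ hd.ne', mul_assoc, mul_comm (t - h)]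
    have h4 : 0 ≤ t - h := by linarith
    calc Real.exp (-1) * ((k - h) / k * t) ≤ Real.exp (-1) * (t - h) := by gcongr
      _ ≤ _ := by gcongr

/-! ### The iteration lemma -/

/-- De Giorgi's iteration lemma, for a quantity that decays at infinity. -/
lemma exists_eq_zero_of_deGiorgi {a : ℝ → ℝ} {B p : ℝ} (ha : ∀ k, 0 ≤ a k) (hanti : Antitone a)
    (hlim : Tendsto a atTop (𝓝 0)) (hB : 0 ≤ B) (hp : 2 < p)
    (hrec : ∀ h k, 1 ≤ h → h < k → a k ≤ B * (k / (k - h)) ^ p * a h ^ (p / 2)) :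
    ∃ K, a K = 0 := by
  set δ := p / 2 - 1 with hδ
  have hδ0 : 0 < δ := by rw [hδ]; linarith
  -- Chosen so that `2^p r^δ = 1`: the geometric decay of `a` then cancels the growth `2^(np)` of
  -- the coefficients.
  set r : ℝ := 2 ^ (-p / δ) with hr
  have hr0 : 0 < r := by positivity
  have hr1 : r < 1 := Real.rpow_lt_one_of_one_lt_of_neg one_lt_two
    (div_neg_of_neg_of_pos (by linarith) hδ0)
  have hrδ : (2 : ℝ) ^ p * r ^ δ = 1 := by
    rw [hr, ← Real.rpow_mul zero_le_two, div_mul_cancel₀ _ hδ0.ne', ← Real.rpow_add two_pos]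
    simp
  set D := B * 4 ^ p with hD
  have hD0 : 0 ≤ D := by positivity
  -- This smallness makes `D η^δ ≤ r`, so each step gains a factor `r`; the `1` keeps the
  -- denominator positive when `D = 0`.
  set η := (r / (D + 1)) ^ (1 / δ) with hη
  have hη0 : 0 < η := by positivity
  have hηδ : D * η ^ δ ≤ r := by
    rw [hη, ← Real.rpow_mul (by positivity), one_div_mul_cancel hδ0.ne', Real.rpow_one,
      mul_div_assoc', div_le_iff₀ (by positivity)]
    nlinarith
  obtain ⟨M, hMη, hM1⟩ := ((hlim.eventually_lt_const hη0).and (eventually_ge_atTop 1)).exists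
  have hM0 : 0 < M := by linarith
  -- The levels increase from `M` towards `2M`. Consecutive ones have `k/(k-h) ≤ 4 * 2^n` whatever
  -- `M` is, so `η` could be fixed before `M`.
  have key : ∀ n : ℕ, a (M * (2 - (1 / 2) ^ n)) ≤ η * r ^ n := by
    intro n
    induction n with
    | zero => norm_num; exact hMη.le
    | succ n ih =>
      have hq0 : (0 : ℝ) < (1 / 2) ^ n := by positivity
      have hq1 : ((1 : ℝ) / 2) ^ n ≤ 1 := pow_le_one₀ (by norm_num) (by norm_num)
      have hlev : M * (2 - (1 / 2) ^ n) < M * (2 - (1 / 2) ^ (n + 1)) := by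
        rw [pow_succ]
        gcongr
        linarith
      have hratio : M * (2 - (1 / 2) ^ (n + 1)) /
          (M * (2 - (1 / 2) ^ (n + 1)) - M * (2 - (1 / 2) ^ n)) ≤ 4 * 2 ^ n := by
        rw [div_le_iff₀ (sub_pos.2 hlev)]
        have : (2 : ℝ) ^ n * (1 / 2) ^ n = 1 := by rw [← mul_pow]; norm_num
        rw [pow_succ]
        have e : 4 * 2 ^ n * (M * (2 - (1 / 2) ^ n * (1 / 2)) - M * (2 - (1 / 2) ^ n)) =
          2 * M * ((2 : ℝ) ^ n * (1 / 2) ^ n) := by ring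
        rw [e, this]
        nlinarith
      have hratio0 : 0 ≤ M * (2 - (1 / 2) ^ (n + 1)) /
          (M * (2 - (1 / 2) ^ (n + 1)) - M * (2 - (1 / 2) ^ n)) := by
        refine div_nonneg (mul_nonneg hM0.le ?_) (sub_pos.2 hlev).le
        rw [pow_succ]
        linarith
      have hpow : (η * r ^ n) ^ (p / 2) = η * r ^ n * (η ^ δ * (r ^ δ) ^ n) := by
        rw [show p / 2 = 1 + δ by rw [hδ]; ring, Real.rpow_add (by positivity), Real.rpow_one,
          Real.mul_rpow hη0.le (by positivity), ← Real.rpow_natCast r n, ← Real.rpow_mul hr0.le,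
          mul_comm (n : ℝ), Real.rpow_mul hr0.le, Real.rpow_natCast (r ^ δ)]
      have hfour : (4 * (2 : ℝ) ^ n) ^ p = 4 ^ p * (2 ^ p) ^ n := by
        rw [Real.mul_rpow (by norm_num) (by positivity), ← Real.rpow_natCast 2 n,
          ← Real.rpow_mul zero_le_two, mul_comm (n : ℝ), Real.rpow_mul zero_le_two,
          Real.rpow_natCast]
      calc a (M * (2 - (1 / 2) ^ (n + 1)))
          ≤ B * (M * (2 - (1 / 2) ^ (n + 1)) /
              (M * (2 - (1 / 2) ^ (n + 1)) - M * (2 - (1 / 2) ^ n))) ^ p *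
              a (M * (2 - (1 / 2) ^ n)) ^ (p / 2) := hrec _ _ (by nlinarith) hlev
        _ ≤ B * (4 * 2 ^ n) ^ p * (η * r ^ n) ^ (p / 2) := by
            have := ha (M * (2 - (1 / 2) ^ n))
            gcongr
        _ = η * r ^ n * (D * η ^ δ) * (2 ^ p * r ^ δ) ^ n := by
            rw [hpow, hfour, hD, mul_pow]
            ring
        _ ≤ η * r ^ n * r := by
            rw [hrδ, one_pow, mul_one]
            gcongr
        _ = η * r ^ (n + 1) := by rw [pow_succ]; ring
  refine ⟨M * 2, le_antisymm ?_ (ha _)⟩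
  have hlim' : Tendsto (fun n : ℕ => η * r ^ n) atTop (𝓝 0) := by
    simpa using (tendsto_pow_atTop_nhds_zero_of_lt_one hr0.le hr1).const_mul η
  refine ge_of_tendsto' hlim' fun n => (hanti ?_).trans (key n)
  gcongr
  have : (0 : ℝ) < (1 / 2) ^ n := by positivity
  linarith

/-! ### Tail integrals -/

/-- `∫_{u > k} |u|^p`. -/
noncomputable def tailIntegral (p : ℝ) (u : Space N → ℝ) (k : ℝ) : ℝ :=
  ∫ x, Set.indicator {x | k < u x} (fun x => |u x| ^ p) x

section tailIntegral

variable {p : ℝ} {u : Space N → ℝ}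

lemma nullMeasurableSet_superlevel (hu : AEStronglyMeasurable u volume) (k : ℝ) :
    NullMeasurableSet {x | k < u x} volume :=
  nullMeasurableSet_lt aemeasurable_const hu.aemeasurable

lemma integrable_indicator_superlevel (hu : AEStronglyMeasurable u volume)
    (hi : Integrable fun x => |u x| ^ p) (k : ℝ) :
    Integrable (Set.indicator {x | k < u x} fun x => |u x| ^ p) :=
  hi.indicator₀ (nullMeasurableSet_superlevel hu k)

lemma indicator_superlevel_nonneg (k : ℝ) (x : Space N) :
    0 ≤ Set.indicator {x | k < u x} (fun x => |u x| ^ p) x :=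
  Set.indicator_nonneg (fun _ _ => by positivity) x

lemma tailIntegral_nonneg (k : ℝ) : 0 ≤ tailIntegral p u k :=
  integral_nonneg (indicator_superlevel_nonneg k)

lemma antitone_tailIntegral (hu : AEStronglyMeasurable u volume)
    (hi : Integrable fun x => |u x| ^ p) : Antitone (tailIntegral p u) := fun h k hk =>
  integral_mono (integrable_indicator_superlevel hu hi k) (integrable_indicator_superlevel hu hi h)
    fun x => Set.indicator_le_indicator_of_subset (fun _ hx => hk.trans_lt hx)
      (fun _ => by positivity) x

lemma tendsto_tailIntegral (hu : AEStronglyMeasurable u volume)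
    (hi : Integrable fun x => |u x| ^ p) : Tendsto (tailIntegral p u) atTop (𝓝 0) := by
  have h : Tendsto (tailIntegral p u) atTop (𝓝 (∫ _ : Space N, (0 : ℝ))) := by
    refine tendsto_integral_filter_of_dominated_convergence (fun x => |u x| ^ p)
      (Eventually.of_forall fun k => (integrable_indicator_superlevel hu hi k).1)
      (Eventually.of_forall fun k => Eventually.of_forall fun x => ?_) hi
      (Eventually.of_forall fun x => ?_)
    · rw [Real.norm_of_nonneg (indicator_superlevel_nonneg k x)]
      exact Set.indicator_le_self' (fun _ _ => by positivity) x
    · refine tendsto_const_nhds.congr' ?_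
      filter_upwards [eventually_ge_atTop (u x)] with k hk
      rw [Set.indicator_of_notMem (by simpa using hk)]
  simpa using h

lemma ae_le_of_tailIntegral_eq_zero (hu : AEStronglyMeasurable u volume)
    (hi : Integrable fun x => |u x| ^ p) {k : ℝ} (hk : 0 ≤ k) (h : tailIntegral p u k = 0) :
    ∀ᵐ x, u x ≤ k := by
  rw [tailIntegral, integral_eq_zero_iff_of_nonneg (indicator_superlevel_nonneg k)
    (integrable_indicator_superlevel hu hi k)] at h
  filter_upwards [h] with x hx
  by_contra! hlt
  rw [Set.indicator_of_mem (by exact hlt)] at hx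
  have h0 : 0 < |u x| := abs_pos.2 (by linarith)
  exact (Real.rpow_pos_of_pos h0 p).ne' hx

end tailIntegral

/-! ### Energy estimate and recursion between levels -/

lemma critExp_le_critExp_one (hN : 3 ≤ N) (hs1 : s < 1) :
    critExp N s ≤ critExp N 1 := by
  have h : (3 : ℝ) ≤ N := by exact_mod_cast hN
  rw [critExp, critExp]
  exact div_le_div_of_nonneg_left (by positivity) (by linarith) (by linarith)

/-- For `t ≥ 1` the larger exponent dominates; this is why the truncation levels start at `1`. -/
lemma abs_mul_self_le_of_growth (hN : 3 ≤ N) (hs1 : s < 1) {f : ℝ → ℝ} {C : ℝ} (hC : 0 ≤ C)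
    (hf : ∀ t : ℝ, |f t * t| ≤ C * (|t| ^ critExp N s + |t| ^ critExp N 1)) {t : ℝ}
    (ht : 1 ≤ t) : |f t * t| ≤ 2 * C * |t| ^ critExp N 1 := by
  have h1 : |t| ^ critExp N s ≤ |t| ^ critExp N 1 :=
    Real.rpow_le_rpow_of_exponent_le (ht.trans (le_abs_self t)) (critExp_le_critExp_one hN hs1)
  refine (hf t).trans ?_
  nlinarith

/-- The increments of `u` and `g ∘ u` have the same sign, so the integrand is pointwise nonnegative.
-/
lemma gagliardoForm_comp_nonneg (s : ℝ) (u : Space N → ℝ) {g : ℝ → ℝ} (hg : Monotone g) :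
    0 ≤ gagliardoForm s u (g ∘ u) := by
  refine integral_nonneg fun p => div_nonneg ?_ (by positivity)
  rcases le_total (u p.1) (u p.2) with h | h
  · exact mul_nonneg_of_nonpos_of_nonpos (sub_nonpos.2 h) (sub_nonpos.2 (hg h))
  · exact mul_nonneg (sub_nonneg.2 h) (sub_nonneg.2 (hg h))

/-- Testing the equation with `g ∘ u`: the nonlocal term has a sign and can be dropped. -/
lemma IsWeakSolution.integral_deriv_mul_sq_le (hN : 3 ≤ N) {κ : ℝ} (hκ : 0 < κ)
    {f : ℝ → ℝ} {u : Space N → ℝ} (hu : IsWeakSolution κ s f u) {H : Space N → Space N}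
    {φ : ℕ → Space N → ℝ} (h : IsApprox s u H φ) {g : ℝ → ℝ} (hg : ContDiff ℝ ∞ g)
    (hg0 : g 0 = 0) (hg1 : ∀ t, deriv g t ∈ Set.Icc 0 1) :
    Integrable (fun x => f (u x) * g (u x)) ∧
      ∫ x, deriv g (u x) * ‖H x‖ ^ 2 ≤ ∫ x, f (u x) * g (u x) := by
  obtain ⟨-, G, hG, htest⟩ := hu
  have hmono : Monotone g :=
    monotone_of_deriv_nonneg (hg.differentiable (by simp)) fun t => (hg1 t).1
  have hcomp := h.comp hg hg0 fun t => abs_le.2 ⟨by linarith [(hg1 t).1], (hg1 t).2⟩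
  obtain ⟨hint, heq⟩ := htest _ _ hcomp.memX (hcomp.isWeakGradient hN)
  refine ⟨hint, ?_⟩
  have e : ∫ x, inner ℝ (G x) (deriv g (u x) • H x) = ∫ x, deriv g (u x) * ‖H x‖ ^ 2 := by
    refine integral_congr_ae ?_
    filter_upwards [hG.ae_eq (h.isWeakGradient hN)] with x hx
    rw [hx, real_inner_smul_right, real_inner_self_eq_norm_sq]
  have := mul_nonneg hκ.le (gagliardoForm_comp_nonneg s u hmono)
  simp only [Function.comp] at heq this
  linarith

/-- Since `0 ≤ g' ≤ 1`, one has `(g')² ≤ g'`. This turns the energy obtained by testing with `g ∘ u`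
into a bound for its full gradient. -/
lemma IsApprox.eLpNorm_deriv_smul_le {u : Space N → ℝ} {H : Space N → Space N}
    {φ : ℕ → Space N → ℝ} (h : IsApprox s u H φ) {g : ℝ → ℝ} (hg : ContDiff ℝ ∞ g)
    (hg1 : ∀ t, deriv g t ∈ Set.Icc 0 1) :
    eLpNorm (fun x => deriv g (u x) • H x) 2 volume ≤
      ENNReal.ofReal (√(∫ x, deriv g (u x) * ‖H x‖ ^ 2)) := by
  have hsq : Integrable fun x => ‖H x‖ ^ 2 :=
    (memLp_two_iff_integrable_sq_norm h.memLp_gradient.1).1 h.memLp_gradient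
  have hnn : ∀ x, 0 ≤ deriv g (u x) * ‖H x‖ ^ 2 := fun x => mul_nonneg (hg1 _).1 (by positivity)
  have hint : Integrable fun x => deriv g (u x) * ‖H x‖ ^ 2 := by
    refine hsq.mono' (((hg.continuous_deriv (by simp)).comp_aestronglyMeasurable h.memLp.1).mul
      hsq.1) (Eventually.of_forall fun x => ?_)
    rw [Real.norm_of_nonneg (hnn x)]
    exact mul_le_of_le_one_left (by positivity) (hg1 _).2
  rw [← ENNReal.pow_le_pow_left_iff two_ne_zero, eLpNorm_two_sq, ← ENNReal.ofReal_pow (Real.sqrt_nonneg _),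
    Real.sq_sqrt (integral_nonneg hnn), ofReal_integral_eq_lintegral_ofReal hint
    (Eventually.of_forall hnn)]
  refine lintegral_mono fun x => ?_
  rw [← ofReal_norm, ← ENNReal.ofReal_pow (norm_nonneg _)]
  refine ENNReal.ofReal_le_ofReal ?_
  rw [norm_smul, mul_pow, Real.norm_of_nonneg (hg1 _).1]
  have := hg1 (u x)
  gcongr
  nlinarith [this.1, this.2]

lemma IsWeakSolution.exists_tailIntegral_le (hN : 3 ≤ N) (hs0 : 0 < s) (hs1 : s < 1) {κ : ℝ}
    (hκ : 0 < κ) {f : ℝ → ℝ} {C : ℝ} (hC : 0 ≤ C)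
    (hf : ∀ t : ℝ, |f t * t| ≤ C * (|t| ^ critExp N s + |t| ^ critExp N 1))
    {u : Space N → ℝ} (hu : IsWeakSolution κ s f u) :
    ∃ B, 0 ≤ B ∧ ∀ h k, 1 ≤ h → h < k →
      tailIntegral (critExp N 1) u k ≤
        B * (k / (k - h)) ^ critExp N 1 * tailIntegral (critExp N 1) u h ^ (critExp N 1 / 2) := by
  obtain ⟨H, φ, hA⟩ := hu.1.exists_isApprox hN hs0 hs1
  have hp := two_lt_critExp_one hN
  have hp0 : 0 < critExp N 1 := by linarith
  set p := critExp N 1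
  set S : ℝ :=
    NNReal.toReal (SNormLESNormFDerivOfEqConst ℝ (volume : Measure (Space N)) 2)
  have hS0 : 0 ≤ S := NNReal.coe_nonneg _
  have hpE0 : ENNReal.ofReal p ≠ 0 := by simpa using hp0
  have hpR : (ENNReal.ofReal p).toReal = p := ENNReal.toReal_ofReal hp0.le
  have hpow : ∀ {v : Space N → ℝ}, MemLp v (ENNReal.ofReal p) volume →
      Integrable fun x => |v x| ^ p := fun hv => by
    simpa [hpR] using hv.integrable_norm_rpow hpE0 ENNReal.ofReal_ne_top
  -- The factor `exp 1` inverts the loss in the lower bound for the truncation, `S` is the Sobolev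
  -- constant, and `√(2C)` comes from the energy bound.
  refine ⟨(Real.exp 1 * S * √(2 * C)) ^ p, by positivity, fun h k hh hk => ?_⟩
  obtain ⟨g, hg, hg1, hgz, hgle, hgge⟩ := exists_smooth_truncation (by linarith : 0 ≤ h) hk
  have hg0 : g 0 = 0 := hgz 0 (by linarith)
  have hcomp := hA.comp hg hg0 fun t => abs_le.2 ⟨by linarith [(hg1 t).1], (hg1 t).2⟩
  set a := tailIntegral p u with ha
  have hah : 0 ≤ a h := tailIntegral_nonneg h
  have hui := hpow hA.memLp
  have hum := hA.memLp.1
  have henergy : ∫ x, deriv g (u x) * ‖H x‖ ^ 2 ≤ 2 * C * a h := by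
    obtain ⟨hint, hle⟩ := hu.integral_deriv_mul_sq_le hN hκ hA hg hg0 hg1
    refine hle.trans ?_
    rw [ha, tailIntegral, ← integral_const_mul]
    refine integral_mono hint ((integrable_indicator_superlevel hum hui h).const_mul _) fun x => ?_
    simp only
    rcases le_or_gt (u x) h with hx | hx
    · rw [Set.indicator_of_notMem (by simpa using hx), hgz _ hx]
      simp
    · rw [Set.indicator_of_mem (by exact hx)]
      refine le_trans ?_ (abs_mul_self_le_of_growth hN hs1 hC hf (hh.trans hx.le))
      refine (le_abs_self _).trans ?_
      rw [abs_mul, abs_mul]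
      have h1 := hgle _ hx.le
      rw [abs_of_nonneg h1.1, abs_of_nonneg (h1.1.trans h1.2)]
      gcongr
      exact h1.2
  have hsob : (∫ x, |g (u x)| ^ p) ≤ (S * √(2 * C * a h)) ^ p := by
    have h1 := hcomp.eLpNorm_le hN
    have h2 := (hA.eLpNorm_deriv_smul_le hg hg1).trans
      (ENNReal.ofReal_le_ofReal (Real.sqrt_le_sqrt henergy))
    rw [hcomp.memLp.eLpNorm_eq_integral_rpow_norm hpE0 ENNReal.ofReal_ne_top, hpR] at h1
    have h3 := h1.trans (mul_le_mul_right h2 _)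
    rw [← ENNReal.ofReal_coe_nnreal, ← ENNReal.ofReal_mul hS0,
      ENNReal.ofReal_le_ofReal_iff (by positivity)] at h3
    have h4 := Real.rpow_le_rpow (by positivity) h3 hp0.le
    rwa [← Real.rpow_mul (by positivity), inv_mul_cancel₀ hp0.ne', Real.rpow_one] at h4
  have hk0 : 0 < k := by linarith
  have hkh : 0 < k - h := sub_pos.2 hk
  -- The truncation is comparable to `u` itself on `{u > k}`, so the same quantity `a` appears on
  -- both sides of the recursion.
  have hlow : (Real.exp (-1) * ((k - h) / k)) ^ p * a k ≤ ∫ x, |g (u x)| ^ p := by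
    rw [ha, tailIntegral, ← integral_const_mul]
    refine integral_mono ((integrable_indicator_superlevel hum hui k).const_mul _)
      (hpow hcomp.memLp) fun x => ?_
    simp only
    rcases le_or_gt (u x) k with hx | hx
    · rw [Set.indicator_of_notMem (by simpa using hx), mul_zero]
      positivity
    · rw [Set.indicator_of_mem (by exact hx), ← Real.mul_rpow (by positivity) (abs_nonneg _)]
      refine Real.rpow_le_rpow (by positivity) ?_ hp0.le
      rw [abs_of_pos (by linarith : 0 < u x)]
      exact (hgge _ hx.le).trans (le_abs_self _)
  have hfac : (Real.exp (-1) * ((k - h) / k)) * (Real.exp 1 * (k / (k - h))) = 1 := by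
    rw [Real.exp_neg]
    field_simp
  calc a k = (Real.exp 1 * (k / (k - h))) ^ p *
        ((Real.exp (-1) * ((k - h) / k)) ^ p * a k) := by
        rw [← mul_assoc, ← Real.mul_rpow (by positivity) (by positivity), mul_comm (Real.exp 1 * _),
          hfac, Real.one_rpow, one_mul]
    _ ≤ (Real.exp 1 * (k / (k - h))) ^ p * (S * √(2 * C * a h)) ^ p := by
        gcongr
        exact hlow.trans hsob
    _ = (Real.exp 1 * S * √(2 * C)) ^ p * (k / (k - h)) ^ p * a h ^ (p / 2) := by
        have e : a h ^ (p / 2) = √(a h) ^ p := by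
          rw [Real.sqrt_eq_rpow, ← Real.rpow_mul hah]
          ring_nf
        rw [e, Real.sqrt_mul (by positivity), ← Real.mul_rpow (by positivity) (by positivity),
          ← Real.mul_rpow (by positivity) (by positivity),
          ← Real.mul_rpow (by positivity) (by positivity)]
        ring_nf

end MixedLocalNonlocal

theorem theorem1p3 (N : ℕ) (hN : 3 ≤ N) (s : ℝ) (hs0 : 0 < s) (hs1 : s < 1)
    (κ : ℝ) (hκ : 0 < κ) (f : ℝ → ℝ)
    (hf : ∃ C : ℝ, 0 < C ∧ ∀ t : ℝ,
      |f t * t| ≤ C * (|t| ^ MixedLocalNonlocal.critExp N s +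
        |t| ^ MixedLocalNonlocal.critExp N 1))
    (u : MixedLocalNonlocal.Space N → ℝ)
    (hu : MixedLocalNonlocal.IsWeakSolution κ s f u)
    (hu0 : ∀ᵐ x ∂volume, 0 ≤ u x) :
    MemLp u ∞ volume := by
  open MixedLocalNonlocal in
  obtain ⟨C, hC, hf⟩ := hf
  obtain ⟨B, hB, hrec⟩ := hu.exists_tailIntegral_le hN hs0 hs1 hκ hC.le hf
  have hp := two_lt_critExp_one hN
  have hm := hu.1.1.1
  have hi : Integrable fun x => |u x| ^ critExp N 1 := by
    have h := hu.1.1.integrable_norm_rpow (by simpa using by linarith) ENNReal.ofReal_ne_top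
    simpa [ENNReal.toReal_ofReal (by linarith : 0 ≤ critExp N 1)] using h
  have hanti := antitone_tailIntegral hm hi
  obtain ⟨K, hK⟩ := exists_eq_zero_of_deGiorgi tailIntegral_nonneg hanti
    (tendsto_tailIntegral hm hi) hB hp hrec
  -- A nonnegative level is needed so that `|u|^p` is positive on `{u > k}`. The iteration bounds
  -- `u` only from above; the bound from below is `u ≥ 0`.
  have hK' : tailIntegral (critExp N 1) u (max K 0) = 0 :=
    le_antisymm ((hanti (le_max_left K 0)).trans hK.le) (tailIntegral_nonneg _)
  refine memLp_top_of_bound hm (max K 0) ?_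
  filter_upwards [hu0, ae_le_of_tailIntegral_eq_zero hm hi (le_max_right K 0) hK'] with x h0 h1
  rwa [Real.norm_of_nonneg h0]
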